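/- For $a>0$ let $\phi_a^{+}$ and $\phi_a^{-}$ be the even entire functions solving $$\phi_a^{\pm}(x)\pm\int_0^a 2\cos(2\pi xy)\,\phi_a^{\pm}(y)\,dy = 2\cos(2\pi ax),$$ and, for $u\in\mathbb R$, $a=e^u$ and $s\in\mathbb C$ with $\Re(s)<1$, put $$J(u,s)=a^{\frac12-s}-\sqrt a\int_0^a\phi_a^+(x)\,x^{-s}\,dx,\qquad K(u,s)=i\,a^{\frac12-s}+i\sqrt a\int_0^a\phi_a^-(x)\,x^{-s}\,dx .$$ Let $W_1(u,s)=\Im\bigl(-J(u,s)\,\overline{K(u,s)}\bigr)$. Then: 1. For every $a>0$ each of the two equations has exactly one even entire solution, so that $J$ and $K$ are well defined. 2. For $s=\frac12+iE$ with $E\in\mathbb R$, and for every $u\in\mathbb R$, $$\Im\bigl(-J(u,s)\,\overline{K(u,s)}\bigr)=1 .$$ 3. Hence $J(u,s)\neq0$ and $K(u,s)\neq0$ for all $u\in\mathbb R$ and all $s$ with $\Re(s)=\frac12$. 4. For all $u\in\mathbb R$ and all $s$ with $\Re(s)<\frac12$ one has $W_1(u,s)>0$; in particular $J(u,s)\neq0$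 and $K(u,s)\neq0$. 5. For $s=\frac12+iE$ with $E\in\mathbb C$ and $\Re(s)<1$, and every $u\in\mathbb R$, $$\frac{d}{du}W_1(u,s)=\Im(E)\,\bigl(|J(u,s)|^2+|K(u,s)|^2\bigr).$$ 6. For $\Re(s)<1$, as $u\to-\infty$ (that is, $a=e^u\to0^+$): $J(u,s)\sim a^{\frac12-s}$, $K(u,s)\sim i\,a^{\frac12-s}$ and $W_1(u,s)\sim a^{1-2\Re(s)}$. -/

import Mathlib

open Filter Topology Asymptotics ComplexConjugate

/-- `φ` is an even entire function solving
`φ(z) + ε ∫₀ᵃ 2 cos(2π z y) φ(y) dy = 2 cos(2π a z)`. -/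
def IsCosineSolution (ε a : ℝ) (φ : ℂ → ℂ) : Prop :=
  Differentiable ℂ φ ∧ (∀ z : ℂ, φ (-z) = φ z) ∧
    ∀ z : ℂ, φ z + (ε : ℂ) * ∫ y in (0 : ℝ)..a, 2 * Complex.cos (2 * Real.pi * z * y) * φ y
      = 2 * Complex.cos (2 * Real.pi * a * z)

/-- The even entire function `φ_a^+` (for `ε = 1`), respectively `φ_a^-` (for `ε = -1`):
the solution of the equation in `IsCosineSolution`. Existence and uniqueness for `a > 0` are not
assumed anywhere; they are part of the theorem below. -/
noncomputable def cosinePhi (ε a : ℝ) : ℂ → ℂ :=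
  Classical.epsilon (IsCosineSolution ε a)

/-- `J(u, s) = a^{1/2 - s} - √a ∫₀ᵃ φ_a^+(x) x^{-s} dx` with `a = exp u`, for `Re s < 1`. -/
noncomputable def solJ (u : ℝ) (s : ℂ) : ℂ :=
  (Real.exp u : ℂ) ^ (1 / 2 - s)
    - (Real.sqrt (Real.exp u) : ℂ)
      * ∫ x in (0 : ℝ)..Real.exp u, cosinePhi 1 (Real.exp u) x * (x : ℂ) ^ (-s)

/-- `K(u, s) = i a^{1/2 - s} + i √a ∫₀ᵃ φ_a^-(x) x^{-s} dx` with `a = exp u`, for `Re s < 1`. -/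
noncomputable def solK (u : ℝ) (s : ℂ) : ℂ :=
  Complex.I * (Real.exp u : ℂ) ^ (1 / 2 - s)
    + Complex.I * (Real.sqrt (Real.exp u) : ℂ)
      * ∫ x in (0 : ℝ)..Real.exp u, cosinePhi (-1) (Real.exp u) x * (x : ℂ) ^ (-s)

/-- `W₁(u, s) = Im(-J(u, s) · conj K(u, s))`. -/
noncomputable def wronskianOne (u : ℝ) (s : ℂ) : ℝ :=
  (-(solJ u s) * conj (solK u s)).im

/-!
The cosine transform restricted to `[0, a]` is rescaled by `x = a t` to an operator `C_a = cosOp a` on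
`C([0,1], ℂ)`. Its kernel is an entire function of `t y`, so it is compact. If `f = ∓ C_a f`, then `f`
and its Fourier transform agree up to sign on `[-a, a]`, so by Plancherel's theorem the transform has
no mass outside `[-a, a]`; being entire, it vanishes (`eq_zero_of_add_cosOp_eq_zero`). The Fredholm
alternative then inverts `1 ± C_a` (`isUnit_one_add_cosOp`), which gives existence and uniqueness of
`φ_a^±`; an entire solution is recovered from its values on `[0, a]` by the equation itself.

The rescaled solutions `φ^ε(t) = φ_a^ε(a t)`, with `ε = ±1`, are obtained by applying
`Ring.inverse (1 + ε C_a)`, hence are analytic in `a`, also at `a = 0`, where `C_0 = 0`. The kernel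
depends on `t y` only, so `t d/dt + 1/2` anticommutes with `C_a` up to a boundary term. Therefore
`a d/da φ^ε` and
`t d/dt φ^ε + t d/dt φ^{-ε} + φ^{-ε}/2 - (1/2 + ε μ) φ^ε`, where `μ = a (φ^+(1) + φ^-(1))`,
have the same image under `1 + ε C_a`, and so coincide (`hasDerivAt_rescaledPhi`). Integrating against
`t^{-s}` turns this into the first order system, with `' = d/du` and `a = exp u`,
`J' = -i (1/2 - s) K - μ J`, `K' = i (1/2 - s) J + μ K`.
As `μ` is real it drops out of the derivative of `W₁ = Im(-J conj K)`, and the differential identity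
follows (`hasDerivAt_wronskianOne`).

Continuity at `a = 0` gives the asymptotics. On the critical line `W₁` is constant with limit `1`;
to its left `W₁` is nondecreasing in `u` and positive near `-∞`, hence positive.
-/

open MeasureTheory unitInterval

/-! ### Plancherel's theorem for `L¹ ∩ L²` -/

open SchwartzMap FourierTransform in
/-- The `L²` Fourier transform of a function in `L¹ ∩ L²` is given by the Fourier integral: both
define the same tempered distribution. -/
theorem fourier_toLp_ae_eq {g : ℝ → ℂ} (h1 : Integrable g) (h2 : MemLp g 2) :
    (𝓕 (h2.toLp g) : Lp ℂ 2 (volume : Measure ℝ)) =ᵐ[volume] 𝓕 g := by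
  have hcont : Continuous (𝓕 g) :=
    VectorFourier.fourierIntegral_continuous Real.continuous_fourierChar
      (by exact continuous_inner) h1
  refine ae_eq_of_integral_contDiff_smul_eq
    ((Lp.memLp (𝓕 (h2.toLp g))).locallyIntegrable (by norm_num)) hcont.locallyIntegrable ?_
  intro ψ hψ hψc
  have hc : HasCompactSupport (fun x => (ψ x : ℂ)) :=
    hψc.comp_left (g := fun x : ℝ => (x : ℂ)) (by simp)
  let ψs : 𝓢(ℝ, ℂ) := hc.toSchwartzMap (Complex.ofRealCLM.contDiff.comp hψ)
  have e1 := congrArg (fun T => T ψs) (Lp.fourier_toTemperedDistribution_eq (h2.toLp g))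
  simp only [TemperedDistribution.fourier_apply, Lp.toTemperedDistribution_apply] at e1
  have e2 : ∫ x, (𝓕 ψs) x • (h2.toLp g : ℝ → ℂ) x = ∫ x, (𝓕 ψs) x • g x := by
    apply integral_congr_ae
    filter_upwards [h2.coeFn_toLp] with x hx
    rw [hx]
  have e3 : ∫ x, (𝓕 ψs) x • g x = ∫ x, ψs x • 𝓕 g x := by
    have := VectorFourier.integral_fourierIntegral_smul_eq_flip (L := innerₗ ℝ)
      (μ := volume) (ν := volume) Real.continuous_fourierChar continuous_inner
      ψs.integrable h1
    simpa [SchwartzMap.fourier_coe] using! this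
  have e4 : ∀ (F : ℝ → ℂ), ∫ x, ψ x • F x = ∫ x, ψs x • F x := by
    intro F; congr 1
  rw [e4, e4, ← e3, ← e2, e1]

/-- Plancherel's theorem for the Fourier integral of a function in `L¹ ∩ L²`. -/
theorem eLpNorm_fourier_eq {g : ℝ → ℂ} (h1 : Integrable g)
    (h2 : MemLp g 2) :
    eLpNorm (FourierTransform.fourier g : ℝ → ℂ) 2 volume
      = eLpNorm g 2 volume := by
  rw [← eLpNorm_congr_ae (fourier_toLp_ae_eq h1 h2),
    ← eLpNorm_congr_ae h2.coeFn_toLp]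
  have := Lp.norm_fourier_eq (h2.toLp g)
  rw [Lp.norm_def, Lp.norm_def] at this
  exact (ENNReal.toReal_eq_toReal_iff' (Lp.eLpNorm_ne_top _)
    (Lp.eLpNorm_ne_top _)).1 this

/-! ### Kernel operators on `C([0,1], ℂ)` -/

section Cosine

variable {K : Type*} [TopologicalSpace K]

/-- The function `x ↦ cos (w p(x))` on a compact space, for a complex parameter `w`. -/
noncomputable def cosC (p : C(K, ℂ)) (w : ℂ) : C(K, ℂ) :=
  ⟨fun x => Complex.cos (w * p x), by fun_prop⟩

/-- The function `x ↦ sin (w p(x))` on a compact space, for a complex parameter `w`. -/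
noncomputable def sinC (p : C(K, ℂ)) (w : ℂ) : C(K, ℂ) :=
  ⟨fun x => Complex.sin (w * p x), by fun_prop⟩

@[simp] theorem cosC_apply (p : C(K, ℂ)) (w : ℂ) (x : K) : cosC p w x = Complex.cos (w * p x) := rfl

@[simp] theorem sinC_apply (p : C(K, ℂ)) (w : ℂ) (x : K) : sinC p w x = Complex.sin (w * p x) := rfl

variable [CompactSpace K]

theorem exp_continuousMap_apply (f : C(K, ℂ)) (x : K) :
    NormedSpace.exp f x = Complex.exp (f x) := by
  rw [Complex.exp_eq_exp_ℂ]
  exact NormedSpace.map_exp (ContinuousMap.evalAlgHom ℂ ℂ x) (continuous_eval_const x) f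

theorem cosC_eq_exp (p : C(K, ℂ)) (w : ℂ) :
    cosC p w = (1 / 2 : ℂ) • (NormedSpace.exp (w • (Complex.I • p))
      + NormedSpace.exp (w • (-Complex.I • p))) := by
  ext x
  simp only [cosC_apply, ContinuousMap.smul_apply, ContinuousMap.add_apply,
    exp_continuousMap_apply, Complex.cos, smul_eq_mul]
  ring_nf

theorem hasDerivAt_cosC (p : C(K, ℂ)) (w : ℂ) :
    HasDerivAt (cosC p) (-(p * sinC p w)) w := by
  have h := ((hasDerivAt_exp_smul_const (Complex.I • p) w).add
    (hasDerivAt_exp_smul_const (-Complex.I • p) w)).const_smul (1 / 2 : ℂ)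
  have e : cosC p = fun w => (1 / 2 : ℂ) • (NormedSpace.exp (w • (Complex.I • p))
      + NormedSpace.exp (w • (-Complex.I • p))) := funext (cosC_eq_exp p)
  rw [e]
  refine h.congr_deriv ?_
  ext x
  simp only [ContinuousMap.neg_apply, ContinuousMap.mul_apply, sinC_apply,
    ContinuousMap.smul_apply, ContinuousMap.add_apply,
    exp_continuousMap_apply, Complex.sin, smul_eq_mul]
  ring_nf

end Cosine

/-- Integration against an integrable weight `w`, as a functional on `C([0,1], ℂ)`. -/
noncomputable def weightCLM (w : I → ℂ) (hw : Integrable w) : C(I, ℂ) →L[ℂ] ℂ :=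
  LinearMap.mkContinuous
    { toFun := fun f => ∫ t, f t * w t
      map_add' := fun f g => by
        have h : ∀ f : C(I, ℂ), Integrable (fun t => f t * w t) := fun f =>
          hw.bdd_mul f.continuous.aestronglyMeasurable (Eventually.of_forall f.norm_coe_le_norm)
        simp only [ContinuousMap.add_apply, add_mul]
        exact integral_add (h f) (h g)
      map_smul' := fun c f => by
        simp only [ContinuousMap.smul_apply, smul_eq_mul, mul_assoc, RingHom.id_apply]
        exact integral_const_mul _ _ }
    (∫ t, ‖w t‖) (fun f => by
      simp only [LinearMap.coe_mk, AddHom.coe_mk]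
      rw [mul_comm, ← integral_const_mul]
      refine norm_integral_le_of_norm_le (hw.norm.const_mul _) (Eventually.of_forall fun t => ?_)
      rw [norm_mul]
      exact mul_le_mul_of_nonneg_right (f.norm_coe_le_norm t) (norm_nonneg _))

theorem weightCLM_apply (w : I → ℂ) (hw : Integrable w) (f : C(I, ℂ)) :
    weightCLM w hw f = ∫ t, f t * w t := rfl

theorem integrable_continuousMap (f : C(I, ℂ)) : Integrable (fun t => f t) :=
  f.continuous.integrable_of_hasCompactSupport (HasCompactSupport.of_compactSpace _)

/-- The integral operator `f ↦ (t ↦ ∫₀¹ κ(t, y) f(y) dy)` on `C([0,1], ℂ)`, as a continuous linear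
function of its kernel `κ`. -/
noncomputable def kernelOp : C(I × I, ℂ) →L[ℂ] C(I, ℂ) →L[ℂ] C(I, ℂ) :=
  LinearMap.mkContinuous₂
    (LinearMap.mk₂ ℂ
      (fun (κ : C(I × I, ℂ)) (f : C(I, ℂ)) =>
        (⟨fun t => ∫ y, κ (t, y) * f y, by
          have := continuous_parametric_integral_of_continuous (μ := (volume : Measure I))
            (f := fun t y => κ (t, y) * f y) (by fun_prop) (s := Set.univ) isCompact_univ
          simpa using this⟩ : C(I, ℂ)))
      (fun κ₁ κ₂ f => by
        ext t
        have h : ∀ κ : C(I × I, ℂ), Integrable (fun y => κ (t, y) * f y) := fun κ =>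
          integrable_continuousMap ⟨fun y => κ (t, y) * f y, by fun_prop⟩
        simp only [ContinuousMap.add_apply, ContinuousMap.coe_mk, add_mul]
        exact integral_add (h κ₁) (h κ₂))
      (fun c κ f => by
        ext t
        simp only [ContinuousMap.smul_apply, ContinuousMap.coe_mk, smul_eq_mul, mul_assoc]
        exact integral_const_mul _ _)
      (fun κ f₁ f₂ => by
        ext t
        have h : ∀ f : C(I, ℂ), Integrable (fun y => κ (t, y) * f y) := fun f =>
          integrable_continuousMap ⟨fun y => κ (t, y) * f y, by fun_prop⟩
        simp only [ContinuousMap.add_apply, ContinuousMap.coe_mk, mul_add]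
        exact integral_add (h f₁) (h f₂))
      (fun c κ f => by
        ext t
        simp only [ContinuousMap.smul_apply, ContinuousMap.coe_mk, smul_eq_mul, mul_left_comm _ c]
        exact integral_const_mul _ _))
    1 (fun κ f => by
      rw [one_mul, ContinuousMap.norm_le _ (by positivity)]
      intro t
      refine (norm_integral_le_of_norm_le_const (C := ‖κ‖ * ‖f‖)
        (Eventually.of_forall fun y => ?_)).trans (by simp)
      rw [norm_mul]
      exact mul_le_mul (κ.norm_coe_le_norm _) (f.norm_coe_le_norm _) (norm_nonneg _) (norm_nonneg _))

theorem kernelOp_apply (κ : C(I × I, ℂ)) (f : C(I, ℂ)) (t : I) :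
    kernelOp κ f t = ∫ y, κ (t, y) * f y := rfl

/-- The inclusion of `[0,1]` in `ℂ`. -/
noncomputable def idC : C(I, ℂ) := ⟨fun t => ((t : ℝ) : ℂ), by fun_prop⟩

/-- The product of the two coordinates, as a kernel on `[0,1] × [0,1]`. -/
noncomputable def mulC : C(I × I, ℂ) := ⟨fun p => ((p.1 : ℝ) : ℂ) * ((p.2 : ℝ) : ℂ), by fun_prop⟩

@[simp] theorem idC_apply (t : I) : idC t = ((t : ℝ) : ℂ) := rfl

@[simp] theorem mulC_apply (p : I × I) : mulC p = ((p.1 : ℝ) : ℂ) * ((p.2 : ℝ) : ℂ) := rfl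

theorem isCompactOperator_kernelOp_mulC_pow (n : ℕ) : IsCompactOperator (kernelOp (mulC ^ n)) := by
  have e : kernelOp (mulC ^ n) = (ContinuousLinearMap.toSpanSingleton ℂ (idC ^ n)).comp
      (weightCLM (fun t => (idC ^ n) t) (integrable_continuousMap _)) := by
    ext f t
    simp only [kernelOp_apply, ContinuousLinearMap.comp_apply,
      ContinuousLinearMap.toSpanSingleton_apply, weightCLM_apply, ContinuousMap.smul_apply,
      ContinuousMap.pow_apply, mulC_apply, idC_apply, smul_eq_mul]
    rw [← integral_mul_const]
    congr 1; ext y; ring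
  rw [e]
  exact (isCompactOperator_of_locallyCompactSpace_rng
    (ContinuousLinearMap.toSpanSingleton ℂ (idC ^ n))).comp_clm _

/-- The partial sums of the exponential series give finite rank operators, which converge in norm. -/
theorem isCompactOperator_kernelOp_exp (c : ℂ) :
    IsCompactOperator (kernelOp (NormedSpace.exp (c • mulC))) := by
  have hs := (NormedSpace.exp_series_hasSum_exp' (𝕂 := ℂ) (c • mulC)).map kernelOp kernelOp.continuous
  refine isCompactOperator_of_tendsto hs (Eventually.of_forall fun s => ?_)
  have : ∑ i ∈ s, (kernelOp ∘ fun n : ℕ => ((n.factorial : ℂ)⁻¹) • (c • mulC) ^ n) i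
      ∈ compactOperator (RingHom.id ℂ) C(I, ℂ) C(I, ℂ) := by
    refine Submodule.sum_mem _ fun n _ => ?_
    simp only [Function.comp, smul_pow, map_smul]
    exact Submodule.smul_mem _ _ (Submodule.smul_mem _ _ (isCompactOperator_kernelOp_mulC_pow n))
  exact this

theorem isCompactOperator_kernelOp_cosC (w : ℂ) : IsCompactOperator (kernelOp (cosC mulC w)) := by
  rw [cosC_eq_exp, map_smul, map_add, smul_smul, smul_smul]
  exact ((isCompactOperator_kernelOp_exp _).add (isCompactOperator_kernelOp_exp _)).smul (1 / 2 : ℂ)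

theorem integral_unitInterval (g : ℝ → ℂ) : ∫ t : I, g t = ∫ t in (0 : ℝ)..1, g t := by
  rw [intervalIntegral.integral_of_le zero_le_one, ← integral_Icc_eq_integral_Ioc]
  exact unitInterval.measurePreserving_coe.integral_comp unitInterval.measurableEmbedding_coe g

/-! ### The cosine transform on an interval and the invertibility of `1 ± C_a` -/

/-- The cosine transform `w ↦ ∫₀¹ 2 cos(w y) f(y) dy` of a continuous function on `[0,1]`. -/
noncomputable def cosInt (f : C(I, ℂ)) (w : ℂ) : ℂ :=
  ∫ y : I, 2 * Complex.cos (w * ((y : ℝ) : ℂ)) * f y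

theorem cosInt_eq_weightCLM (f : C(I, ℂ)) (w : ℂ) :
    cosInt f w = weightCLM f (integrable_continuousMap f) ((2 : ℂ) • cosC idC w) := by
  rw [weightCLM_apply]; rfl

theorem hasDerivAt_cosInt (f : C(I, ℂ)) (w : ℂ) :
    HasDerivAt (cosInt f)
      (∫ y : I, -(2 * ((y : ℝ) : ℂ) * Complex.sin (w * ((y : ℝ) : ℂ))) * f y) w := by
  have h := (weightCLM f (integrable_continuousMap f)).hasFDerivAt.comp_hasDerivAt w
    ((hasDerivAt_cosC idC w).const_smul (2 : ℂ))
  have e : cosInt f = weightCLM f (integrable_continuousMap f) ∘ fun w => (2 : ℂ) • cosC idC w :=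
    funext (cosInt_eq_weightCLM f)
  rw [e]
  refine h.congr_deriv ?_
  rw [weightCLM_apply]
  refine integral_congr_ae (Eventually.of_forall fun y => ?_)
  simp only [ContinuousMap.smul_apply, ContinuousMap.neg_apply, ContinuousMap.mul_apply,
    idC_apply, sinC_apply, smul_eq_mul]
  ring

theorem differentiable_cosInt (f : C(I, ℂ)) : Differentiable ℂ (cosInt f) :=
  fun w => (hasDerivAt_cosInt f w).differentiableAt

theorem cosInt_neg (f : C(I, ℂ)) (w : ℂ) : cosInt f (-w) = cosInt f w := by
  simp only [cosInt, neg_mul, Complex.cos_neg]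

/-- The cosine transform restricted to `[0, a]`, transported to `[0,1]` by the dilation `x = a t`. -/
noncomputable def cosOp (a : ℂ) : C(I, ℂ) →L[ℂ] C(I, ℂ) :=
  (2 * a) • kernelOp (cosC mulC (2 * Real.pi * a ^ 2))

theorem cosOp_apply (a : ℂ) (f : C(I, ℂ)) (t : I) :
    cosOp a f t = a * cosInt f (2 * Real.pi * a ^ 2 * ((t : ℝ) : ℂ)) := by
  simp only [cosOp, smul_apply, ContinuousMap.smul_apply, kernelOp_apply, cosInt,
    smul_eq_mul, cosC_apply, mulC_apply, mul_assoc (2 : ℂ) (Complex.cos _) _, integral_const_mul]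
  rw [mul_comm 2 a, mul_assoc]
  simp only [mul_assoc]

theorem isCompactOperator_cosOp (a : ℂ) : IsCompactOperator (cosOp a) :=
  (isCompactOperator_kernelOp_cosC _).smul (2 * a)

/-- The even extension of `y ↦ f (y / a)` from `[0, a]` to `[-a, a]`, extended by zero. -/
noncomputable def evenExt (a : ℝ) (f : C(I, ℂ)) : ℝ → ℂ :=
  (Set.Icc (-a) a).indicator fun y => f (Set.projIcc 0 1 zero_le_one (|y| / a))

theorem continuous_evenExt_aux (a : ℝ) (f : C(I, ℂ)) :
    Continuous fun y : ℝ => f (Set.projIcc 0 1 zero_le_one (|y| / a)) := by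
  have : Continuous fun y : ℝ => Set.projIcc (0 : ℝ) 1 zero_le_one (|y| / a) :=
    continuous_projIcc.comp (by fun_prop)
  exact f.continuous.comp this

theorem memLp_evenExt (a : ℝ) (f : C(I, ℂ)) (p : ENNReal) : MemLp (evenExt a f) p := by
  refine (memLp_indicator_iff_restrict measurableSet_Icc).2 ?_
  exact MemLp.of_bound (continuous_evenExt_aux a f).aestronglyMeasurable ‖f‖
    (Eventually.of_forall fun _ => f.norm_coe_le_norm _)

theorem fourier_evenExt {a : ℝ} (ha : 0 < a) (f : C(I, ℂ)) (x : ℝ) :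
    FourierTransform.fourier (evenExt a f) x = a * cosInt f (2 * Real.pi * a * x) := by
  set h : ℝ → ℂ := fun y => f (Set.projIcc 0 1 zero_le_one (|y| / a)) with hh
  have hc : Continuous h := continuous_evenExt_aux a f
  have heven : ∀ y, h (-y) = h y := fun y => by simp [hh]
  have e1 : FourierTransform.fourier (evenExt a f) x
      = ∫ y in (-a)..a, Complex.exp (-(2 * Real.pi * x * y) * Complex.I) * h y := by
    rw [Real.fourier_eq', intervalIntegral.integral_of_le (by linarith),
      ← integral_Icc_eq_integral_Ioc, ← integral_indicator measurableSet_Icc]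
    refine integral_congr_ae (Eventually.of_forall fun y => ?_)
    by_cases hy : y ∈ Set.Icc (-a) a
    · simp only [evenExt, Set.indicator_of_mem hy, smul_eq_mul, hh]
      congr 2
      simp
      ring
    · simp [evenExt, Set.indicator_of_notMem hy]
  have hint : ∀ b c : ℝ, IntervalIntegrable
      (fun y : ℝ => Complex.exp (-(2 * Real.pi * x * y) * Complex.I) * h y) volume b c := fun b c =>
    Continuous.intervalIntegrable (by fun_prop) _ _
  have hint' : ∀ b c : ℝ, IntervalIntegrable
      (fun y : ℝ => Complex.exp ((2 * Real.pi * x * y) * Complex.I) * h y) volume b c := fun b c =>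
    Continuous.intervalIntegrable (by fun_prop) _ _
  have e2 : ∫ y in (-a)..0, Complex.exp (-(2 * Real.pi * x * y) * Complex.I) * h y
      = ∫ y in (0 : ℝ)..a, Complex.exp ((2 * Real.pi * x * y) * Complex.I) * h y := by
    have := intervalIntegral.integral_comp_neg (a := 0) (b := a)
      (fun y : ℝ => Complex.exp (-(2 * Real.pi * x * y) * Complex.I) * h y)
    rw [neg_zero] at this
    rw [← this]
    refine intervalIntegral.integral_congr fun y _ => ?_
    simp only [heven]
    congr 2
    push_cast
    ring
  have e3 : ∫ y in (0 : ℝ)..a, 2 * Complex.cos (2 * Real.pi * x * y) * h y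
      = a * ∫ t in (0 : ℝ)..1, 2 * Complex.cos (2 * Real.pi * a * x * t) * h (a * t) := by
    have := intervalIntegral.smul_integral_comp_mul_left (a := 0) (b := 1)
      (fun y : ℝ => 2 * Complex.cos (2 * Real.pi * x * y) * h y) a
    rw [mul_zero, mul_one] at this
    rw [← this, Complex.real_smul]
    congr 1
    refine intervalIntegral.integral_congr fun y _ => ?_
    push_cast
    congr 3
    ring
  rw [e1, ← intervalIntegral.integral_add_adjacent_intervals (hint _ 0) (hint _ _), e2,
    ← intervalIntegral.integral_add (hint' _ _) (hint _ _), cosInt]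
  have e4 := integral_unitInterval
    (fun t => 2 * Complex.cos (2 * Real.pi * a * x * t) * h (a * t))
  have e5 : ∀ t : I, h (a * t) = f t := fun t => by
    have : |a * (t : ℝ)| / a = t := by
      rw [abs_of_nonneg (mul_nonneg ha.le t.2.1)]; field_simp
    simp only [hh, this, Set.projIcc_val]
  simp only [e5] at e4
  rw [e4, ← e3]
  refine intervalIntegral.integral_congr fun y _ => ?_
  simp only [Complex.cos]
  ring_nf

/-- A function that the cosine transform of `[0, a]` maps to `±` itself vanishes. By Plancherel's
theorem its transform has no mass outside `[-a, a]`, and the transform is analytic. -/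
theorem eq_zero_of_add_cosOp_eq_zero {a ε : ℝ} (ha : 0 < a) (hε : ε ^ 2 = 1) {f : C(I, ℂ)}
    (hf : f + (ε : ℂ) • cosOp a f = 0) : f = 0 := by
  -- `F` is the Fourier transform of the even extension `g` of `f`, and `|F| = |g|` on `[-a, a]`.
  set F : ℂ → ℂ := fun z => a * cosInt f (2 * Real.pi * a * z) with hF
  have hFd : Differentiable ℂ F :=
    ((differentiable_cosInt f).comp (differentiable_id.const_mul _)).const_mul _
  have hFt : ∀ t : I, F ((a * t : ℝ) : ℂ) = cosOp a f t := fun t => by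
    rw [cosOp_apply]; simp only [hF]; push_cast; ring_nf
  have hft : ∀ t : I, f t = -(ε : ℂ) * cosOp a f t := fun t => by
    have := congrArg (fun g : C(I, ℂ) => g t) hf
    simp only [ContinuousMap.add_apply, ContinuousMap.smul_apply, smul_eq_mul,
      ContinuousMap.zero_apply] at this
    linear_combination this
  have hε1 : ‖-(ε : ℂ)‖ = 1 := by
    rw [norm_neg, Complex.norm_real, Real.norm_eq_abs]
    exact (pow_eq_one_iff_of_nonneg (abs_nonneg ε) two_ne_zero).1 (by rw [sq_abs, hε])
  have hnorm : ∀ t : I, ‖f t‖ = ‖F ((a * t : ℝ) : ℂ)‖ := fun t => by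
    rw [hFt, hft, norm_mul, hε1, one_mul]
  have hFeven : ∀ z, F (-z) = F z := fun z => by
    simp only [hF, mul_neg, cosInt_neg]
  set g := evenExt a f with hg
  have hgF : ∀ x ∈ Set.Icc (-a) a, ‖g x‖ = ‖F x‖ := fun x hx => by
    have h1 : |x| / a ∈ Set.Icc (0 : ℝ) 1 :=
      ⟨by positivity, (div_le_one ha).2 (abs_le.2 ⟨hx.1, hx.2⟩)⟩
    simp only [hg, evenExt, Set.indicator_of_mem hx]
    rw [hnorm, Set.projIcc_of_mem _ h1]
    have : a * (|x| / a) = |x| := by field_simp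
    simp only [this]
    rcases abs_choice x with h | h <;> rw [h]
    rw [Complex.ofReal_neg, hFeven]
  -- Plancherel: `∫_ℝ |F|² = ∫_{[-a,a]} |g|² = ∫_{[-a,a]} |F|²`, so `F` vanishes a.e. outside `[-a, a]`.
  have hPl := eLpNorm_fourier_eq ((memLp_one_iff_integrable).1 (memLp_evenExt a f 1))
    (memLp_evenExt a f 2)
  have hfou : (FourierTransform.fourier (evenExt a f) : ℝ → ℂ) = fun x : ℝ => F x := by
    ext x; rw [fourier_evenExt ha]
  have hfin := (memLp_evenExt a f 2).eLpNorm_lt_top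
  rw [hfou] at hPl
  rw [← hPl] at hfin
  have hcF : Continuous fun x : ℝ => F x := hFd.continuous.comp Complex.continuous_ofReal
  rw [eLpNorm_eq_lintegral_rpow_enorm_toReal (by norm_num) (by norm_num),
    eLpNorm_eq_lintegral_rpow_enorm_toReal (by norm_num) (by norm_num)] at hPl
  rw [eLpNorm_lt_top_iff_lintegral_rpow_enorm_lt_top (by norm_num) (by norm_num)] at hfin
  simp only [ENNReal.toReal_ofNat, ENNReal.rpow_ofNat] at hPl hfin
  replace hPl := ENNReal.rpow_left_injective (by norm_num) hPl
  have hgint : ∫⁻ x, ‖evenExt a f x‖ₑ ^ 2 = ∫⁻ x in Set.Icc (-a) a, ‖F x‖ₑ ^ 2 := by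
    rw [← lintegral_indicator measurableSet_Icc]
    refine lintegral_congr fun x => ?_
    by_cases hx : x ∈ Set.Icc (-a) a
    · rw [Set.indicator_of_mem hx, ← ofReal_norm, ← ofReal_norm, ← hgF x hx]
    · rw [Set.indicator_of_notMem hx, evenExt, Set.indicator_of_notMem hx]; simp
  rw [hgint, ← lintegral_add_compl _ (measurableSet_Icc (a := -a) (b := a))] at hPl
  have hzero : ∫⁻ x in (Set.Icc (-a) a)ᶜ, ‖F x‖ₑ ^ 2 = 0 := by
    refine (ENNReal.add_right_inj (a := ∫⁻ x in Set.Icc (-a) a, ‖F x‖ₑ ^ 2) ?_).1 (by simpa using hPl)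
    exact ((setLIntegral_le_lintegral _ _).trans_lt hfin).ne
  have hae : (fun x : ℝ => F x) =ᵐ[volume.restrict (Set.Ioi a)] fun _ => 0 := by
    have h1 : ∀ᵐ x : ℝ ∂volume.restrict (Set.Icc (-a) a)ᶜ, ‖F x‖ₑ ^ 2 = 0 := by
      rw [lintegral_eq_zero_iff (hcF.measurable.enorm.pow_const 2)] at hzero
      exact hzero
    have hsub : Set.Ioi a ⊆ (Set.Icc (-a) a)ᶜ := fun x hx h => not_lt.2 h.2 hx
    filter_upwards [ae_restrict_of_ae_restrict_of_subset hsub h1] with x hx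
    simpa using hx
  have hIoi : Set.EqOn (fun x : ℝ => F x) (fun _ => 0) (Set.Ioi a) :=
    Measure.eqOn_open_of_ae_eq hae isOpen_Ioi hcF.continuousOn continuousOn_const
  -- The zeros of the entire function `F` accumulate at `a + 1`.
  have hF0 : F = 0 := by
    refine AnalyticOnNhd.eq_of_frequently_eq (z₀ := ((a + 1 : ℝ) : ℂ))
      (fun z _ => hFd.analyticAt z) analyticOnNhd_const ?_
    have ht : Tendsto (fun x : ℝ => (x : ℂ)) (𝓝[>] (a + 1)) (𝓝[≠] ((a + 1 : ℝ) : ℂ)) := by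
      refine tendsto_nhdsWithin_iff.2 ⟨(Complex.continuous_ofReal.tendsto _).mono_left inf_le_left, ?_⟩
      filter_upwards [self_mem_nhdsWithin] with x hx
      have hx' : a + 1 < x := hx
      simpa only [Set.mem_compl_iff, Set.mem_singleton_iff, Complex.ofReal_inj] using ne_of_gt hx'
    refine ht.frequently (Eventually.frequently ?_)
    filter_upwards [self_mem_nhdsWithin] with x hx
    exact hIoi (lt_trans (by linarith) hx : a < x)
  ext t
  have := hnorm t
  rw [hF0] at this
  simpa using this

/-- The operator `1 ± C_a` is invertible, by the Fredholm alternative. -/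
theorem isUnit_one_add_cosOp {a ε : ℝ} (ha : 0 < a) (hε : ε ^ 2 = 1) :
    IsUnit (1 + (ε : ℂ) • cosOp a) := by
  have hε0 : ε ≠ 0 := fun h => by simp [h] at hε
  have hεε : (ε : ℂ) ^ 2 = 1 := by exact_mod_cast hε
  have hμ : (-(ε : ℂ)) ≠ 0 := by simpa using hε0
  rcases (isCompactOperator_cosOp a).hasEigenvalue_or_mem_resolventSet hμ with h | h
  · exfalso
    obtain ⟨f, hf⟩ := h.exists_hasEigenvector
    refine hf.2 (eq_zero_of_add_cosOp_eq_zero ha hε ?_)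
    have : cosOp a f = -(ε : ℂ) • f := hf.apply_eq_smul
    rw [this, smul_smul]
    ext t
    simp only [ContinuousMap.add_apply, ContinuousMap.smul_apply, smul_eq_mul,
      ContinuousMap.zero_apply]
    linear_combination -hεε * f t
  · rw [spectrum.mem_resolventSet_iff] at h
    have h2 : IsUnit ((-(ε : ℂ)) • (algebraMap ℂ (C(I, ℂ) →L[ℂ] C(I, ℂ)) (-(ε : ℂ)) - cosOp a)) := by
      have := (h.smul (Units.mk0 _ hμ))
      exact this
    convert h2 using 1
    ext f t
    simp [Algebra.algebraMap_eq_smul_one]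
    linear_combination -hεε * f t

/-! ### Existence and uniqueness of `φ_a^±`, and formulas for `J` and `K` -/

/-- The right-hand side `2 cos(2π a x)` at `x = a t`, as a function of `t ∈ [0,1]`. -/
noncomputable def cosRhs (a : ℂ) : C(I, ℂ) := (2 : ℂ) • cosC idC (2 * Real.pi * a ^ 2)

theorem cosRhs_apply (a : ℂ) (t : I) :
    cosRhs a t = 2 * Complex.cos (2 * Real.pi * a ^ 2 * ((t : ℝ) : ℂ)) := rfl

/-- The solution rescaled to the unit interval, `t ↦ φ_a(a t)`. It is defined for every complex `a`
through `Ring.inverse`, so that it is analytic wherever `1 + ε C_a` is invertible, in particular near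
`a = 0` and near each `a > 0`. -/
noncomputable def rescaledPhi (ε a : ℂ) : C(I, ℂ) := Ring.inverse (1 + ε • cosOp a) (cosRhs a)

theorem rescaledPhi_add {a ε : ℝ} (ha : 0 < a) (hε : ε ^ 2 = 1) :
    rescaledPhi ε a + (ε : ℂ) • cosOp a (rescaledPhi ε a) = cosRhs a := by
  have h := congrArg (fun T => T (cosRhs a)) (Ring.mul_inverse_cancel _ (isUnit_one_add_cosOp ha hε))
  simpa using! h

theorem eq_of_add_cosOp_eq {a ε : ℝ} (ha : 0 < a) (hε : ε ^ 2 = 1) {f g : C(I, ℂ)}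
    (h : f + (ε : ℂ) • cosOp a f = g + (ε : ℂ) • cosOp a g) : f = g := by
  refine sub_eq_zero.1 (eq_zero_of_add_cosOp_eq_zero ha hε ?_)
  rw [map_sub, smul_sub, ← sub_eq_zero.2 h]
  abel

theorem integral_cos_mul_eq_cosInt {a : ℝ} {φ : ℂ → ℂ} {f : C(I, ℂ)}
    (hf : ∀ t : I, f t = φ ((a * t : ℝ) : ℂ)) (z : ℂ) :
    ∫ y in (0 : ℝ)..a, 2 * Complex.cos (2 * Real.pi * z * y) * φ y
      = a * cosInt f (2 * Real.pi * a * z) := by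
  have h := intervalIntegral.smul_integral_comp_mul_left (a := 0) (b := 1)
    (fun y : ℝ => 2 * Complex.cos (2 * Real.pi * z * y) * φ y) a
  rw [mul_zero, mul_one] at h
  rw [← h, Complex.real_smul, cosInt, ← integral_unitInterval
    (fun x : ℝ => 2 * Complex.cos (2 * Real.pi * z * ((a * x : ℝ) : ℂ)) * φ ((a * x : ℝ) : ℂ))]
  congr 1
  refine integral_congr_ae (Eventually.of_forall fun t => ?_)
  simp only [hf]
  push_cast
  congr 3
  ring

theorem IsCosineSolution.apply_mul {a ε : ℝ} (ha : 0 < a) (hε : ε ^ 2 = 1) {φ : ℂ → ℂ}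
    (h : IsCosineSolution ε a φ) (t : I) : φ ((a * t : ℝ) : ℂ) = rescaledPhi ε a t := by
  have hc : Continuous φ := h.1.continuous
  set f : C(I, ℂ) := ⟨fun t => φ ((a * t : ℝ) : ℂ), by fun_prop⟩ with hf
  have hft : ∀ t : I, f t = φ ((a * t : ℝ) : ℂ) := fun t => rfl
  suffices f = rescaledPhi ε a by rw [← hft, this]
  refine eq_of_add_cosOp_eq ha hε ?_
  rw [rescaledPhi_add ha hε]
  ext t
  have h3 := h.2.2 ((a * t : ℝ) : ℂ)
  rw [integral_cos_mul_eq_cosInt hft] at h3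
  simp only [ContinuousMap.add_apply, ContinuousMap.smul_apply, smul_eq_mul, cosOp_apply,
    cosRhs_apply, hft]
  push_cast at h3 ⊢
  rw [show 2 * Real.pi * (a : ℂ) * (a * ((t : ℝ) : ℂ)) = 2 * Real.pi * a ^ 2 * ((t : ℝ) : ℂ) by ring]
    at h3
  exact h3

/-- The entire function that the integral equation recovers from the values of its solution on
`[0, a]`. -/
noncomputable def entirePhi (ε a : ℝ) (z : ℂ) : ℂ :=
  2 * Complex.cos (2 * Real.pi * a * z)
    - ε * (a * cosInt (rescaledPhi ε a) (2 * Real.pi * a * z))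

theorem entirePhi_mul {a ε : ℝ} (ha : 0 < a) (hε : ε ^ 2 = 1) (t : I) :
    rescaledPhi ε a t = entirePhi ε a ((a * t : ℝ) : ℂ) := by
  have h := congrArg (fun g : C(I, ℂ) => g t) (rescaledPhi_add ha hε)
  simp only [ContinuousMap.add_apply, ContinuousMap.smul_apply, smul_eq_mul, cosOp_apply,
    cosRhs_apply] at h
  rw [entirePhi, eq_sub_iff_add_eq.2 h]
  push_cast
  ring_nf

theorem isCosineSolution_entirePhi {a ε : ℝ} (ha : 0 < a) (hε : ε ^ 2 = 1) :
    IsCosineSolution ε a (entirePhi ε a) := by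
  have hd : Differentiable ℂ fun z : ℂ => cosInt (rescaledPhi ε a) (2 * Real.pi * a * z) :=
    (differentiable_cosInt _).comp (differentiable_id.const_mul _)
  refine ⟨?_, fun z => ?_, fun z => ?_⟩
  · unfold entirePhi
    fun_prop
  · simp only [entirePhi, mul_neg, Complex.cos_neg, cosInt_neg]
  · rw [integral_cos_mul_eq_cosInt (entirePhi_mul ha hε), entirePhi]
    ring

theorem existsUnique_isCosineSolution {a ε : ℝ} (ha : 0 < a) (hε : ε ^ 2 = 1) :
    ∃! φ : ℂ → ℂ, IsCosineSolution ε a φ := by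
  refine ⟨_, isCosineSolution_entirePhi ha hε, fun φ hφ => funext fun z => ?_⟩
  have h3 := hφ.2.2 z
  rw [integral_cos_mul_eq_cosInt (fun t => (hφ.apply_mul ha hε t).symm)] at h3
  rw [entirePhi]
  linear_combination h3

theorem cosinePhi_mul {a ε : ℝ} (ha : 0 < a) (hε : ε ^ 2 = 1) (t : I) :
    cosinePhi ε a ((a * t : ℝ) : ℂ) = rescaledPhi ε a t :=
  IsCosineSolution.apply_mul ha hε
    (Classical.epsilon_spec (existsUnique_isCosineSolution ha hε).exists) t

theorem integrable_unitInterval {g : ℝ → ℂ} (hg : IntervalIntegrable g volume 0 1) :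
    Integrable fun t : I => g t := by
  have h := (intervalIntegrable_iff_integrableOn_Icc_of_le zero_le_one).1 hg
  exact (unitInterval.measurePreserving_coe.integrable_comp_emb
    unitInterval.measurableEmbedding_coe).2 h

theorem integrable_cpow_neg {s : ℂ} (hs : s.re < 1) :
    Integrable fun t : I => (((t : ℝ) : ℂ)) ^ (-s) :=
  integrable_unitInterval (g := fun t => (t : ℂ) ^ (-s))
    (intervalIntegral.intervalIntegrable_cpow' (by simpa using hs))

/-- The Mellin functional `f ↦ ∫₀¹ f(t) t^{-s} dt` on `C([0,1], ℂ)`, for `Re s < 1`. -/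
noncomputable def mellinCLM {s : ℂ} (hs : s.re < 1) : C(I, ℂ) →L[ℂ] ℂ :=
  weightCLM (fun t => (((t : ℝ) : ℂ)) ^ (-s)) (integrable_cpow_neg hs)

theorem sqrt_mul_integral_cosinePhi {a ε : ℝ} (ha : 0 < a) (hε : ε ^ 2 = 1) {s : ℂ} (hs : s.re < 1) :
    (Real.sqrt a : ℂ) * ∫ x in (0 : ℝ)..a, cosinePhi ε a x * (x : ℂ) ^ (-s)
      = (a : ℂ) ^ (1 / 2 - s) * (a * mellinCLM hs (rescaledPhi ε a)) := by
  have h := intervalIntegral.smul_integral_comp_mul_left (a := 0) (b := 1)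
    (fun x : ℝ => cosinePhi ε a x * (x : ℂ) ^ (-s)) a
  rw [mul_zero, mul_one] at h
  rw [← h, Complex.real_smul, ← integral_unitInterval
    (fun x : ℝ => cosinePhi ε a ((a * x : ℝ) : ℂ) * ((a * x : ℝ) : ℂ) ^ (-s))]
  have e : ∫ t : I, cosinePhi ε a ((a * t : ℝ) : ℂ) * ((a * t : ℝ) : ℂ) ^ (-s)
      = (a : ℂ) ^ (-s) * mellinCLM hs (rescaledPhi ε a) := by
    rw [mellinCLM, weightCLM_apply, ← integral_const_mul]
    refine integral_congr_ae (Eventually.of_forall fun t => ?_)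
    simp only [cosinePhi_mul ha hε]
    rw [Complex.ofReal_mul, Complex.mul_cpow_ofReal_nonneg ha.le t.2.1]
    ring
  have hq : (Real.sqrt a : ℂ) = (a : ℂ) ^ (1 / 2 : ℂ) := by
    rw [Real.sqrt_eq_rpow, Complex.ofReal_cpow ha.le]; norm_num
  rw [e, hq, sub_eq_add_neg (1 / 2 : ℂ) s, Complex.cpow_add _ _ (by exact_mod_cast ha.ne')]
  ring

theorem solJ_eq (u : ℝ) {s : ℂ} (hs : s.re < 1) :
    solJ u s = (Real.exp u : ℂ) ^ (1 / 2 - s)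
      * (1 - Real.exp u * mellinCLM hs (rescaledPhi 1 (Real.exp u))) := by
  rw [solJ, sqrt_mul_integral_cosinePhi (Real.exp_pos u) (by norm_num) hs]
  push_cast
  ring

theorem solK_eq (u : ℝ) {s : ℂ} (hs : s.re < 1) :
    solK u s = Complex.I * ((Real.exp u : ℂ) ^ (1 / 2 - s)
      * (1 + Real.exp u * mellinCLM hs (rescaledPhi (-1) (Real.exp u)))) := by
  rw [solK, mul_assoc Complex.I, sqrt_mul_integral_cosinePhi (Real.exp_pos u) (by norm_num) hs]
  push_cast
  ring

/-! ### The Euler operator `t d/dt` and integration by parts -/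

/-- `h = t f'(t)` on `[0,1]`: the function `f` extends differentiably to the line and `h` is its
image under the Euler operator `t d/dt`. -/
def IsEulerDeriv (f h : C(I, ℂ)) : Prop :=
  ∃ G G' : ℝ → ℂ, (∀ x, HasDerivAt G (G' x) x) ∧
    ∀ t : I, G t = f t ∧ ((t : ℝ) : ℂ) * G' t = h t

/-- Integration by parts for the Euler operator, against a weight `k` such that `q(t) = t k(t)` is
continuous on `[0,1]` with `q(0) = 0`. -/
theorem IsEulerDeriv.integral_mul_add_integral_mul {f h : C(I, ℂ)} (hfh : IsEulerDeriv f h)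
    {k q q' : ℝ → ℂ}
    (hq : ContinuousOn q (Set.Icc 0 1)) (hq0 : q 0 = 0)
    (hqk : ∀ x ∈ Set.Ioo (0 : ℝ) 1, q x = x * k x)
    (hq' : ∀ x ∈ Set.Ioo (0 : ℝ) 1, HasDerivAt q (q' x) x)
    (hk : IntervalIntegrable k volume 0 1) (hq'i : IntervalIntegrable q' volume 0 1) :
    (∫ t : I, h t * k t) + ∫ t : I, f t * q' t = f 1 * q 1 := by
  obtain ⟨G, G', hG, hGt⟩ := hfh
  have hGc : Continuous G := continuous_iff_continuousAt.2 fun x => (hG x).continuousAt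
  set H : ℝ → ℂ := fun x => h (Set.projIcc 0 1 zero_le_one x) with hH
  have hHc : Continuous H := h.continuous.comp continuous_projIcc
  have hHt : ∀ t : I, h t = H t := fun t => by simp only [hH, Set.projIcc_val]
  have hi1 : IntervalIntegrable (fun x => H x * k x) volume 0 1 := hk.continuousOn_mul hHc.continuousOn
  have hi2 : IntervalIntegrable (fun x => G x * q' x) volume 0 1 :=
    hq'i.continuousOn_mul hGc.continuousOn
  have hftc := intervalIntegral.integral_eq_sub_of_hasDerivAt_of_le (f := fun x => G x * q x)
    (f' := fun x => H x * k x + G x * q' x) zero_le_one (hGc.continuousOn.mul hq) (fun x hx => by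
      refine ((hG x).mul (hq' x hx)).congr_deriv ?_
      have h1 := (hGt ⟨x, hx.1.le, hx.2.le⟩).2
      rw [hHt] at h1
      simp only at h1
      rw [hqk x hx, ← h1]
      ring) (hi1.add hi2)
  rw [intervalIntegral.integral_add hi1 hi2, hq0, mul_zero, sub_zero] at hftc
  have h1 := (hGt 1).1
  rw [← integral_unitInterval, ← integral_unitInterval] at hftc
  simp only [← hHt, (hGt _).1] at hftc
  rw [hftc, ← h1]
  simp

/-- The operator whose kernel is `t ∂/∂t` of the kernel of `cosOp a`. -/
noncomputable def eulerCosOp (a : ℂ) : C(I, ℂ) →L[ℂ] C(I, ℂ) :=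
  (-(4 * Real.pi * a ^ 3)) • kernelOp (mulC * sinC mulC (2 * Real.pi * a ^ 2))

/-- The image of `cosRhs a` under the Euler operator `t d/dt`. -/
noncomputable def eulerCosRhs (a : ℂ) : C(I, ℂ) :=
  (-(4 * Real.pi * a ^ 2)) • (idC * sinC idC (2 * Real.pi * a ^ 2))

theorem eulerCosOp_apply (a : ℂ) (f : C(I, ℂ)) (t : I) :
    eulerCosOp a f t = -(4 * Real.pi * a ^ 3) * ∫ y : I, ((t : ℝ) : ℂ) * ((y : ℝ) : ℂ)
      * Complex.sin (2 * Real.pi * a ^ 2 * (((t : ℝ) : ℂ) * ((y : ℝ) : ℂ))) * f y := rfl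

theorem isEulerDeriv_sub_cosOp (ε a : ℂ) (f : C(I, ℂ)) :
    IsEulerDeriv (cosRhs a - ε • cosOp a f) (eulerCosRhs a - ε • eulerCosOp a f) := by
  have hlin : ∀ x : ℝ,
      HasDerivAt (fun x : ℝ => 2 * Real.pi * a ^ 2 * (x : ℂ)) (2 * Real.pi * a ^ 2) x :=
    fun x => by simpa using (Complex.ofRealCLM.hasDerivAt (x := x)).const_mul (2 * Real.pi * a ^ 2)
  refine ⟨fun x => 2 * Complex.cos (2 * Real.pi * a ^ 2 * x)
      - ε * (a * cosInt f (2 * Real.pi * a ^ 2 * x)), _, fun x =>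
      (((Complex.hasDerivAt_cos _).comp x (hlin x)).const_mul 2).sub
      ((((hasDerivAt_cosInt f _).comp x (hlin x)).const_mul a).const_mul ε), fun t => ⟨?_, ?_⟩⟩
  · simp only [ContinuousMap.sub_apply, ContinuousMap.smul_apply, smul_eq_mul, cosOp_apply,
      cosRhs_apply]
  · simp only [ContinuousMap.sub_apply, ContinuousMap.smul_apply, smul_eq_mul, eulerCosOp_apply,
      eulerCosRhs, ContinuousMap.mul_apply, idC_apply, sinC_apply]
    have e : ∫ y : I, ((t : ℝ) : ℂ) * ((y : ℝ) : ℂ)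
          * Complex.sin (2 * Real.pi * a ^ 2 * (((t : ℝ) : ℂ) * ((y : ℝ) : ℂ))) * f y
        = -(1 / 2 * ((t : ℝ) : ℂ)) * ∫ y : I, -(2 * ((y : ℝ) : ℂ)
          * Complex.sin (2 * Real.pi * a ^ 2 * ((t : ℝ) : ℂ) * ((y : ℝ) : ℂ))) * f y := by
      rw [← integral_const_mul]
      refine integral_congr_ae (Eventually.of_forall fun y => ?_)
      simp only [mul_assoc]
      ring
    rw [e]
    ring

theorem IsEulerDeriv.cosOp_add {f h : C(I, ℂ)} (hfh : IsEulerDeriv f h) (a : ℂ) :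
    cosOp a h + cosOp a f + eulerCosOp a f = (a * f 1) • cosRhs a := by
  ext t
  set c : ℂ := 2 * Real.pi * a ^ 2 * ((t : ℝ) : ℂ) with hc
  have hlin : ∀ x : ℝ, HasDerivAt (fun x : ℝ => c * (x : ℂ)) c x :=
    fun x => by simpa using (Complex.ofRealCLM.hasDerivAt (x := x)).const_mul c
  have key := hfh.integral_mul_add_integral_mul (k := fun x => 2 * Complex.cos (c * x))
    (q := fun x => (x : ℂ) * (2 * Complex.cos (c * x)))
    (q' := fun x => 2 * Complex.cos (c * x) + (x : ℂ) * (2 * (-Complex.sin (c * x) * c)))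
    (by fun_prop) (by simp) (fun x _ => rfl) (fun x _ => by
      have h1 := (Complex.ofRealCLM.hasDerivAt (x := x)).mul
        (((Complex.hasDerivAt_cos _).comp x (hlin x)).const_mul 2)
      exact h1.congr_deriv (by simp))
    (Continuous.intervalIntegrable (by fun_prop) _ _) (Continuous.intervalIntegrable (by fun_prop) _ _)
  have e1 : ∫ y : I, f y * (2 * Complex.cos (c * (y : ℝ))
        + ((y : ℝ) : ℂ) * (2 * (-Complex.sin (c * (y : ℝ)) * c)))
      = cosInt f c + ∫ y : I, f y * (((y : ℝ) : ℂ) * (2 * (-Complex.sin (c * (y : ℝ)) * c))) := by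
    have i1 : Integrable fun y : I => 2 * Complex.cos (c * ((y : ℝ) : ℂ)) * f y :=
      integrable_continuousMap ⟨fun y : I => 2 * Complex.cos (c * ((y : ℝ) : ℂ)) * f y, by fun_prop⟩
    have i2 : Integrable fun y : I =>
        f y * (((y : ℝ) : ℂ) * (2 * (-Complex.sin (c * (y : ℝ)) * c))) :=
      integrable_continuousMap ⟨fun y : I =>
        f y * (((y : ℝ) : ℂ) * (2 * (-Complex.sin (c * (y : ℝ)) * c))), by fun_prop⟩
    rw [cosInt, ← integral_add i1 i2]
    refine integral_congr_ae (Eventually.of_forall fun y => ?_)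
    simp only []
    ring
  have e2 : ∫ y : I, h y * (2 * Complex.cos (c * (y : ℝ))) = cosInt h c := by
    rw [cosInt]
    refine integral_congr_ae (Eventually.of_forall fun y => ?_)
    simp only []
    ring
  have e3 : eulerCosOp a f t
      = a * ∫ y : I, f y * (((y : ℝ) : ℂ) * (2 * (-Complex.sin (c * (y : ℝ)) * c))) := by
    rw [eulerCosOp_apply, ← integral_const_mul, ← integral_const_mul]
    refine integral_congr_ae (Eventually.of_forall fun y => ?_)
    simp only [hc, mul_assoc]
    ring
  rw [e1, e2] at key
  simp only [ContinuousMap.add_apply, ContinuousMap.smul_apply, smul_eq_mul, cosOp_apply,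
    cosRhs_apply, e3, ← hc]
  simp only [Complex.ofReal_one, mul_one, one_mul] at key
  linear_combination a * key

theorem IsEulerDeriv.mellinCLM_eq {f h : C(I, ℂ)} (hfh : IsEulerDeriv f h) {s : ℂ} (hs : s.re < 1) :
    mellinCLM hs h = f 1 - (1 - s) * mellinCLM hs f := by
  have hs1 : (1 - s) ≠ 0 := fun h => by
    have := congrArg Complex.re h
    simp at this
    linarith
  have hcont : Continuous fun x : ℝ => (x : ℂ) ^ (1 - s) :=
    Complex.continuous_ofReal_cpow_const (by simpa using hs)
  have hint : IntervalIntegrable (fun x : ℝ => (x : ℂ) ^ (-s)) volume 0 1 :=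
    intervalIntegral.intervalIntegrable_cpow' (by simpa using hs)
  have key := hfh.integral_mul_add_integral_mul (k := fun x => (x : ℂ) ^ (-s))
    (q := fun x => (x : ℂ) ^ (1 - s))
    (q' := fun x => (1 - s) * (x : ℂ) ^ (-s)) hcont.continuousOn
    (by rw [Complex.ofReal_zero, Complex.zero_cpow hs1])
    (fun x hx => by
      have : (x : ℂ) ≠ 0 := by exact_mod_cast hx.1.ne'
      rw [sub_eq_add_neg, Complex.cpow_add _ _ this, Complex.cpow_one])
    (fun x hx => by
      refine (hasDerivAt_ofReal_cpow_const hx.1.ne' hs1).congr_deriv ?_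
      rw [show 1 - s - 1 = -s by ring])
    hint (hint.const_mul _)
  rw [mellinCLM, weightCLM_apply, weightCLM_apply]
  simp only [mul_left_comm _ (1 - s), integral_const_mul] at key
  rw [Complex.ofReal_one, Complex.one_cpow] at key
  linear_combination key

/-! ### Dependence of the solution on `a` -/

theorem hasDerivAt_two_pi_mul_sq (a : ℂ) :
    HasDerivAt (fun a : ℂ => 2 * Real.pi * a ^ 2) (4 * Real.pi * a) a := by
  refine ((hasDerivAt_pow 2 a).const_mul (2 * Real.pi : ℂ)).congr_deriv ?_
  norm_num
  ring

/-- `cosOp` depends analytically on `a`, and `a d/da` acts on its kernel `2 a cos (2π a² t y)` as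
`1 + 2 t ∂/∂t`. -/
theorem exists_hasDerivAt_cosOp (a : ℂ) : ∃ T' : C(I, ℂ) →L[ℂ] C(I, ℂ),
    HasDerivAt cosOp T' a ∧ a • T' = cosOp a + (2 : ℂ) • eulerCosOp a := by
  have h1 := ((hasDerivAt_id a).const_mul (2 : ℂ)).smul
    ((hasDerivAt_cosC mulC (2 * Real.pi * a ^ 2)).scomp a (hasDerivAt_two_pi_mul_sq a))
  have hk : HasFDerivAt (𝕜 := ℂ) (E := C(I × I, ℂ)) (F := C(I, ℂ) →L[ℂ] C(I, ℂ)) kernelOp kernelOp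
      ((2 * a) • cosC mulC (2 * Real.pi * a ^ 2)) := by
    apply ContinuousLinearMap.hasFDerivAt
  have h2 := HasFDerivAt.comp_hasDerivAt (𝕜 := ℂ) (F := C(I × I, ℂ))
    (E := C(I, ℂ) →L[ℂ] C(I, ℂ)) a hk h1
  have e : cosOp = kernelOp ∘ fun a => (2 * a) • cosC mulC (2 * Real.pi * a ^ 2) := by
    ext1 a
    simp only [cosOp, Function.comp, map_smul]
  rw [e]
  refine ⟨_, h2, ?_⟩
  simp only [eulerCosOp, map_smul, map_add, map_neg, Function.comp, id]
  module

theorem exists_hasDerivAt_cosRhs (a : ℂ) : ∃ e' : C(I, ℂ),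
    HasDerivAt cosRhs e' a ∧ a • e' = (2 : ℂ) • eulerCosRhs a := by
  have h1 := (hasDerivAt_cosC idC (2 * Real.pi * a ^ 2)).scomp a (hasDerivAt_two_pi_mul_sq a)
  refine ⟨_, h1.const_smul (2 : ℂ), ?_⟩
  simp only [eulerCosRhs]
  module

/-- The solution `x` of a linear equation `M x = e` is differentiable along with `M` and `e` where `M`
is invertible, and its derivative satisfies the differentiated equation. -/
theorem exists_hasDerivAt_inverse_apply {X : Type*} [NormedAddCommGroup X] [NormedSpace ℂ X]
    [CompleteSpace X] {M : ℂ → X →L[ℂ] X} {M' : X →L[ℂ] X} {e : ℂ → X} {e' : X} {a : ℂ}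
    (hM : HasDerivAt M M' a) (he : HasDerivAt e e' a) (hu : IsUnit (M a)) :
    ∃ x' : X, HasDerivAt (fun w => Ring.inverse (M w) (e w)) x' a ∧
      M a x' + M' (Ring.inverse (M a) (e a)) = e' := by
  obtain ⟨U, hU⟩ := hu
  have hinv := hasFDerivAt_ringInverse (𝕜 := ℂ) U
  rw [hU] at hinv
  refine ⟨_, (hinv.comp_hasDerivAt a hM).clm_apply he, ?_⟩
  have hUi : ∀ x, M a ((U⁻¹ : _ˣ).1 x) = x := fun x => by
    have h := congrArg (fun T => T x) U.mul_inv
    rw [hU] at h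
    simpa using! h
  simp only [← hU, Function.comp, Ring.inverse_unit, neg_apply, ContinuousLinearMap.mulLeftRight_apply,
    mul_apply_eq_comp, map_add, map_neg]
  rw [hU, hUi, hUi]
  abel

/-- Wherever `1 + ε C_a` is invertible the rescaled solution is analytic in `a`; the second conjunct
is the differentiated integral equation. -/
theorem exists_hasDerivAt_rescaledPhi {ε a : ℂ} (hu : IsUnit (1 + ε • cosOp a)) :
    ∃ Φ' : C(I, ℂ), HasDerivAt (rescaledPhi ε) Φ' a ∧
      a • Φ' + ε • cosOp a (a • Φ') + ε • (cosOp a (rescaledPhi ε a)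
        + (2 : ℂ) • eulerCosOp a (rescaledPhi ε a)) = (2 : ℂ) • eulerCosRhs a := by
  obtain ⟨T', hT, hT'⟩ := exists_hasDerivAt_cosOp a
  obtain ⟨e', he, he'⟩ := exists_hasDerivAt_cosRhs a
  have hMd : HasDerivAt (fun w => (1 : C(I, ℂ) →L[ℂ] C(I, ℂ)) + ε • cosOp w) (ε • T') a :=
    HasDerivAt.const_add (𝕜 := ℂ) (F := C(I, ℂ) →L[ℂ] C(I, ℂ)) 1
      (HasDerivAt.const_smul (𝕜 := ℂ) (F := C(I, ℂ) →L[ℂ] C(I, ℂ)) ε hT)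
  obtain ⟨Φ', hΦ, h⟩ := exists_hasDerivAt_inverse_apply (X := C(I, ℂ)) hMd he hu
  refine ⟨Φ', hΦ, ?_⟩
  rw [← he', ← h]
  have hT'' := congrArg (fun T => T (rescaledPhi ε a)) hT'
  simp only [smul_apply, add_apply] at hT''
  rw [← hT'', map_smul]
  change _ = a • ((Φ' + ε • cosOp a Φ') + ε • T' (rescaledPhi ε a))
  module

/-- The image of the rescaled solution under the Euler operator `t d/dt`. -/
noncomputable def eulerPhi (ε a : ℂ) : C(I, ℂ) :=
  eulerCosRhs a - ε • eulerCosOp a (rescaledPhi ε a)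

theorem isEulerDeriv_rescaledPhi {a ε : ℝ} (ha : 0 < a) (hε : ε ^ 2 = 1) :
    IsEulerDeriv (rescaledPhi ε a) (eulerPhi ε a) := by
  have h := isEulerDeriv_sub_cosOp ε a (rescaledPhi ε a)
  rwa [← rescaledPhi_add ha hε, add_sub_cancel_right] at h

/-- The coefficient `μ(a) = a (φ_a^+(a) + φ_a^-(a))` of the differential system for `J` and `K`. -/
noncomputable def muCoeff (a : ℂ) : ℂ := a * (rescaledPhi 1 a 1 + rescaledPhi (-1) a 1)

theorem muCoeff_eq {ε : ℝ} (hε : ε = 1 ∨ ε = -1) (a : ℂ) :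
    a * rescaledPhi ε a 1 + a * rescaledPhi (-ε) a 1 = muCoeff a := by
  rw [muCoeff]
  rcases hε with rfl | rfl
  · push_cast; ring
  · push_cast; rw [neg_neg]; ring

/-- The evolution in `a` couples the two signs. Both sides have the same image under the injective
operator `1 + ε C_a`. -/
theorem hasDerivAt_rescaledPhi {a ε : ℝ} (ha : 0 < a) (hε : ε = 1 ∨ ε = -1) :
    ∃ Φ' : C(I, ℂ), HasDerivAt (rescaledPhi ε) Φ' a ∧ (a : ℂ) • Φ' =
      eulerPhi ε a + eulerPhi (-ε) a + (1 / 2 : ℂ) • rescaledPhi (-ε) a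
        - (1 / 2 + ε * muCoeff a) • rescaledPhi ε a := by
  have hε2 : ε ^ 2 = 1 := by rcases hε with rfl | rfl <;> norm_num
  have hε2' : (-ε) ^ 2 = 1 := by rwa [neg_sq]
  have hεε : (ε : ℂ) ^ 2 = 1 := by exact_mod_cast hε2
  obtain ⟨Φ', hΦ, h⟩ := exists_hasDerivAt_rescaledPhi (isUnit_one_add_cosOp ha hε2)
  refine ⟨Φ', hΦ, eq_of_add_cosOp_eq ha hε2 ?_⟩
  have p1 := rescaledPhi_add ha hε2
  have p2 := rescaledPhi_add ha hε2'
  have q1 := (isEulerDeriv_rescaledPhi ha hε2).cosOp_add a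
  have q2 := (isEulerDeriv_rescaledPhi ha hε2').cosOp_add a
  have hμ := muCoeff_eq hε a
  push_cast at p2 q2
  simp only [map_add, map_sub, map_smul]
  ext t
  have h := congrArg (fun g : C(I, ℂ) => g t) h
  have p1 := congrArg (fun g : C(I, ℂ) => g t) p1
  have p2 := congrArg (fun g : C(I, ℂ) => g t) p2
  have q1 := congrArg (fun g : C(I, ℂ) => g t) q1
  have q2 := congrArg (fun g : C(I, ℂ) => g t) q2
  have r1 : eulerPhi ε a t = eulerCosRhs a t - ε * eulerCosOp a (rescaledPhi ε a) t := rfl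
  have r2 : eulerPhi (-ε) a t = eulerCosRhs a t - -ε * eulerCosOp a (rescaledPhi (-ε) a) t := rfl
  simp only [ContinuousMap.add_apply, ContinuousMap.smul_apply, ContinuousMap.sub_apply,
    smul_eq_mul, map_smul] at *
  generalize cosOp a (rescaledPhi ε a) t = A1 at *
  generalize cosOp a (rescaledPhi (-ε) a) t = A2 at *
  generalize cosOp a (eulerPhi ε a) t = B1 at *
  generalize cosOp a (eulerPhi (-ε) a) t = B2 at *
  generalize eulerCosOp a (rescaledPhi ε a) t = U1 at *
  generalize eulerCosOp a (rescaledPhi (-ε) a) t = U2 at *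
  rw [← hμ] at *
  linear_combination h - r1 - r2 - ε * q1 - ε * q2
    + (ε * (a * rescaledPhi ε a 1 + a * rescaledPhi (-ε) a 1) + 1 / 2) * p1 - 1 / 2 * p2

/-! ### The differential system for `J` and `K`, and its consequences -/

theorem conj_cosInt (f : C(I, ℂ)) (w : ℝ) : conj (cosInt f w) = cosInt (star f) w := by
  rw [cosInt, cosInt, ← integral_conj]
  refine integral_congr_ae (Eventually.of_forall fun y => ?_)
  simp only [map_mul, map_ofNat, ← Complex.cos_conj, Complex.conj_ofReal, ContinuousMap.star_apply]
  rfl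

/-- The rescaled solutions are real on `[0,1]`: their conjugates solve the same equation. -/
theorem conj_rescaledPhi {a ε : ℝ} (ha : 0 < a) (hε : ε ^ 2 = 1) (t : I) :
    conj (rescaledPhi ε a t) = rescaledPhi ε a t := by
  suffices star (rescaledPhi ε a) = rescaledPhi ε a from
    congrArg (fun g : C(I, ℂ) => g t) this
  refine eq_of_add_cosOp_eq ha hε ?_
  ext x
  have hx : (2 * Real.pi * (a : ℂ) ^ 2 * ((x : ℝ) : ℂ)) = ((2 * Real.pi * a ^ 2 * x : ℝ) : ℂ) := by
    push_cast; ring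
  have h := congrArg (fun g : C(I, ℂ) => g x) (rescaledPhi_add ha hε)
  simp only [ContinuousMap.add_apply, ContinuousMap.smul_apply, smul_eq_mul, cosOp_apply,
    cosRhs_apply, hx] at h ⊢
  rw [h, ← conj_cosInt]
  have h2 := congrArg conj h
  simp only [map_add, map_mul, Complex.conj_ofReal, map_ofNat, ← Complex.cos_conj] at h2
  exact h2

theorem conj_muCoeff {a : ℝ} (ha : 0 < a) : conj (muCoeff a) = muCoeff a := by
  have h1 := conj_rescaledPhi ha (ε := 1) (by norm_num) 1
  have h2 := conj_rescaledPhi ha (ε := -1) (by norm_num) 1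
  push_cast at h1 h2
  rw [muCoeff, map_mul, map_add, Complex.conj_ofReal, h1, h2]


theorem exp_cpow (u : ℝ) (c : ℂ) : (Real.exp u : ℂ) ^ c = Complex.exp (c * u) := by
  rw [Complex.cpow_def_of_ne_zero (by exact_mod_cast (Real.exp_pos u).ne'), ← Complex.ofReal_log
    (Real.exp_pos u).le, Real.log_exp, mul_comm]

theorem hasDerivAt_exp_cpow (u : ℝ) (c : ℂ) :
    HasDerivAt (fun v : ℝ => (Real.exp v : ℂ) ^ c) (c * (Real.exp u : ℂ) ^ c) u := by
  simp only [exp_cpow]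
  have h1 := (((hasDerivAt_id (u : ℂ)).const_mul c).cexp).comp_ofReal
  exact h1.congr_deriv (by simp only [id]; ring)

/-- The derivative of `a ∫₀¹ φ_a^ε(a t) t^{-s} dt` with respect to `u = log a`. -/
theorem hasDerivAt_mul_mellinCLM {ε : ℝ} (hε : ε = 1 ∨ ε = -1) (u : ℝ) {s : ℂ} (hs : s.re < 1) :
    HasDerivAt (fun v : ℝ => (Real.exp v : ℂ) * mellinCLM hs (rescaledPhi ε (Real.exp v)))
      (muCoeff (Real.exp u) * (1 - ε * (Real.exp u * mellinCLM hs (rescaledPhi ε (Real.exp u))))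
        - (1 / 2 - s) * (Real.exp u * mellinCLM hs (rescaledPhi ε (Real.exp u)))
        - (1 / 2 - s) * (Real.exp u * mellinCLM hs (rescaledPhi (-ε) (Real.exp u)))) u := by
  have ha := Real.exp_pos u
  have hε2 : ε ^ 2 = 1 := by rcases hε with rfl | rfl <;> norm_num
  have hε2' : (-ε) ^ 2 = 1 := by rwa [neg_sq]
  obtain ⟨Φ', hΦ, h⟩ := hasDerivAt_rescaledPhi ha hε
  rw [Complex.ofReal_exp] at hΦ
  have hd := ((Complex.hasDerivAt_exp u).mul ((mellinCLM hs).hasFDerivAt.comp_hasDerivAt (u : ℂ)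
    (hΦ.scomp (u : ℂ) (Complex.hasDerivAt_exp u)))).comp_ofReal
  have e : (fun v : ℝ => (Real.exp v : ℂ) * mellinCLM hs (rescaledPhi ε (Real.exp v)))
      = fun v : ℝ => (Complex.exp * (mellinCLM hs ∘ rescaledPhi ε ∘ Complex.exp)) v := by
    ext v
    simp
  rw [e]
  refine hd.congr_deriv ?_
  rw [← Complex.ofReal_exp]
  have h1 := (isEulerDeriv_rescaledPhi ha hε2).mellinCLM_eq hs
  have h2 := (isEulerDeriv_rescaledPhi ha hε2').mellinCLM_eq hs
  push_cast at h2
  have hμ := muCoeff_eq hε (Real.exp u)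
  simp only [Function.comp, h, map_add, map_sub, map_smul, smul_eq_mul, ← Complex.ofReal_exp]
  push_cast
  push_cast at h1 h2 hμ
  linear_combination Complex.exp u * h1 + Complex.exp u * h2 + hμ

/-- The first equation of the differential system: `J' = -i(1/2 - s) K - μ J`. -/
theorem hasDerivAt_solJ (u : ℝ) {s : ℂ} (hs : s.re < 1) :
    HasDerivAt (fun v : ℝ => solJ v s)
      (-(Complex.I * (1 / 2 - s)) * solK u s - muCoeff (Real.exp u) * solJ u s) u := by
  have h := (hasDerivAt_exp_cpow u (1 / 2 - s)).mul
    ((hasDerivAt_mul_mellinCLM (ε := 1) (by norm_num) u hs).const_sub 1)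
  have e : (fun v : ℝ => solJ v s) = _ := funext fun v => solJ_eq v hs
  rw [e, solJ_eq u hs, solK_eq u hs]
  push_cast at h ⊢
  refine h.congr_deriv ?_
  ring_nf
  simp only [Complex.I_sq]
  ring

/-- The second equation of the differential system: `K' = i(1/2 - s) J + μ K`. -/
theorem hasDerivAt_solK (u : ℝ) {s : ℂ} (hs : s.re < 1) :
    HasDerivAt (fun v : ℝ => solK v s)
      (Complex.I * (1 / 2 - s) * solJ u s + muCoeff (Real.exp u) * solK u s) u := by
  have h := ((hasDerivAt_exp_cpow u (1 / 2 - s)).mul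
    ((hasDerivAt_mul_mellinCLM (ε := -1) (by norm_num) u hs).const_add 1)).const_mul Complex.I
  have e : (fun v : ℝ => solK v s) = _ := funext fun v => solK_eq v hs
  rw [e, solJ_eq u hs, solK_eq u hs]
  push_cast at h ⊢
  simp only [neg_neg] at h
  refine h.congr_deriv ?_
  ring

/-- The coefficient `μ` is real, so its contributions to the derivative of `W₁` cancel. -/
theorem hasDerivAt_wronskianOne (u : ℝ) {E s : ℂ} (hE : s = 1 / 2 + Complex.I * E) (hs : s.re < 1) :
    HasDerivAt (fun v : ℝ => wronskianOne v s)
      (E.im * (‖solJ u s‖ ^ 2 + ‖solK u s‖ ^ 2)) u := by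
  have hc : Complex.I * (1 / 2 - s) = E := by
    rw [hE]; linear_combination -E * Complex.I_sq
  have hJ := hasDerivAt_solJ u hs
  have hK := hasDerivAt_solK u hs
  rw [hc] at hJ hK
  have h := Complex.imCLM.hasFDerivAt.comp_hasDerivAt u (hJ.neg.mul hK.star)
  refine h.congr_deriv ?_
  have hμ : (muCoeff (Real.exp u)).im = 0 := Complex.conj_eq_iff_im.1 (conj_muCoeff (Real.exp_pos u))
  rw [← Complex.normSq_eq_norm_sq, ← Complex.normSq_eq_norm_sq]
  simp only [Complex.imCLM_apply, Complex.star_def, Complex.normSq_apply, Complex.add_im,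
    Complex.mul_im, Complex.mul_re, Complex.neg_im, Complex.neg_re, Complex.sub_im, Complex.sub_re,
    Complex.conj_im, Complex.conj_re, Complex.add_re, hμ, Pi.neg_apply]
  ring

/-- Since `C_0 = 0`, the rescaled solution is continuous at `a = 0`. -/
theorem tendsto_mul_mellinCLM_atBot (ε : ℂ) {s : ℂ} (hs : s.re < 1) :
    Tendsto (fun u : ℝ => (Real.exp u : ℂ) * mellinCLM hs (rescaledPhi ε (Real.exp u)))
      atBot (𝓝 0) := by
  have hz : 1 + ε • cosOp 0 = 1 := by
    ext f t
    simp [cosOp_apply]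
  have h0 : IsUnit (1 + ε • cosOp 0) := by rw [hz]; exact isUnit_one
  obtain ⟨Φ', hΦ, -⟩ := exists_hasDerivAt_rescaledPhi h0
  have hc : ContinuousAt (fun a : ℂ => a * mellinCLM hs (rescaledPhi ε a)) 0 :=
    continuousAt_id.mul ((mellinCLM hs).continuous.continuousAt.comp hΦ.continuousAt)
  have he : Tendsto (fun u : ℝ => (Real.exp u : ℂ)) atBot (𝓝 0) := by
    have := (Complex.continuous_ofReal.tendsto 0).comp Real.tendsto_exp_atBot
    rwa [Complex.ofReal_zero] at this
  have := hc.tendsto.comp he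
  simpa using! this


/-- The quotient of `W₁` by its leading term is the real part of the product of the quotients
of `J` and of `K` by theirs. -/
theorem wronskianOne_eq (u : ℝ) {s : ℂ} (hs : s.re < 1) :
    wronskianOne u s = ((1 - Real.exp u * mellinCLM hs (rescaledPhi 1 (Real.exp u)))
      * conj (1 + Real.exp u * mellinCLM hs (rescaledPhi (-1) (Real.exp u)))).re
        * Real.exp u ^ (1 - 2 * s.re) := by
  have hn : (Real.exp u : ℂ) ^ (1 / 2 - s) * conj ((Real.exp u : ℂ) ^ (1 / 2 - s))
      = ((Real.exp u ^ (1 - 2 * s.re) : ℝ) : ℂ) := by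
    rw [Complex.mul_conj, Complex.normSq_eq_norm_sq, Complex.norm_cpow_eq_rpow_re_of_pos
      (Real.exp_pos u), ← Real.rpow_natCast, ← Real.rpow_mul (Real.exp_pos u).le]
    congr 2
    simp
    ring
  rw [wronskianOne, solJ_eq u hs, solK_eq u hs]
  simp only [map_mul, Complex.conj_I]
  generalize (1 - (Real.exp u : ℂ) * mellinCLM hs (rescaledPhi 1 (Real.exp u))) = X
  generalize conj (1 + (Real.exp u : ℂ) * mellinCLM hs (rescaledPhi (-1) (Real.exp u))) = Y
  have e : ∀ A B : ℂ, -(A * X) * (-Complex.I * (B * Y)) = Complex.I * (X * Y) * (A * B) :=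
    fun A B => by ring
  rw [e, hn, Complex.im_mul_ofReal, Complex.I_mul_im]

theorem tendsto_wronskianOne_factor {s : ℂ} (hs : s.re < 1) :
    Tendsto (fun u : ℝ => ((1 - Real.exp u * mellinCLM hs (rescaledPhi 1 (Real.exp u)))
      * conj (1 + Real.exp u * mellinCLM hs (rescaledPhi (-1) (Real.exp u)))).re) atBot (𝓝 1) := by
  have h1 := (tendsto_mul_mellinCLM_atBot 1 hs).const_sub 1
  have h2 := (Complex.continuous_conj.tendsto _).comp
    ((tendsto_mul_mellinCLM_atBot (-1) hs).const_add 1)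
  have h := (Complex.continuous_re.tendsto _).comp (h1.mul h2)
  rwa [sub_zero, add_zero, map_one, mul_one, Complex.one_re] at h

theorem solJ_isEquivalent {s : ℂ} (hs : s.re < 1) :
    (fun u : ℝ => solJ u s) ~[atBot] fun u : ℝ => (Real.exp u : ℂ) ^ (1 / 2 - s) := by
  refine isEquivalent_iff_exists_eq_mul.2 ⟨_, ?_, Eventually.of_forall fun u =>
    (solJ_eq u hs).trans (mul_comm _ _)⟩
  simpa using (tendsto_mul_mellinCLM_atBot 1 hs).const_sub 1

theorem solK_isEquivalent {s : ℂ} (hs : s.re < 1) :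
    (fun u : ℝ => solK u s) ~[atBot] fun u : ℝ => Complex.I * (Real.exp u : ℂ) ^ (1 / 2 - s) := by
  refine isEquivalent_iff_exists_eq_mul.2 ⟨_, ?_, Eventually.of_forall fun u =>
    (solK_eq u hs).trans ((mul_assoc _ _ _).symm.trans (mul_comm _ _))⟩
  simpa using (tendsto_mul_mellinCLM_atBot (-1) hs).const_add 1

theorem wronskianOne_isEquivalent {s : ℂ} (hs : s.re < 1) :
    (fun u : ℝ => wronskianOne u s) ~[atBot] fun u : ℝ => Real.exp u ^ (1 - 2 * s.re) :=
  isEquivalent_iff_exists_eq_mul.2 ⟨_, tendsto_wronskianOne_factor hs,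
    Eventually.of_forall fun u => wronskianOne_eq u hs⟩

theorem solJ_ne_zero_and_solK_ne_zero {u : ℝ} {s : ℂ} (h : wronskianOne u s ≠ 0) :
    solJ u s ≠ 0 ∧ solK u s ≠ 0 :=
  ⟨fun h0 => h (by simp [wronskianOne, h0]), fun h0 => h (by simp [wronskianOne, h0])⟩

/-- On the critical line `W₁` is constant in `u`, and its limit at `-∞` is `1`. -/
theorem wronskianOne_eq_one (u : ℝ) {s : ℂ} (hs : s.re = 1 / 2) : wronskianOne u s = 1 := by
  have hs1 : s.re < 1 := by rw [hs]; norm_num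
  have hE : s = 1 / 2 + Complex.I * ((s.im : ℝ) : ℂ) := by
    apply Complex.ext <;> simp [hs]
  have hd : ∀ v, HasDerivAt (fun v : ℝ => wronskianOne v s) 0 v := fun v => by
    simpa using hasDerivAt_wronskianOne v hE hs1
  have hconst : ∀ v, wronskianOne v s = wronskianOne u s := fun v =>
    is_const_of_deriv_eq_zero (fun v => (hd v).differentiableAt) (fun v => (hd v).deriv) v u
  have ht : Tendsto (fun v : ℝ => wronskianOne v s) atBot (𝓝 1) := by
    refine (tendsto_wronskianOne_factor hs1).congr fun v => ?_
    rw [wronskianOne_eq v hs1, hs]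
    norm_num
  simp only [hconst] at ht
  exact tendsto_nhds_unique tendsto_const_nhds ht

/-- To the left of the critical line `W₁` is nondecreasing in `u`, and positive near `-∞`. -/
theorem wronskianOne_pos (u : ℝ) {s : ℂ} (hs : s.re < 1 / 2) : 0 < wronskianOne u s := by
  have hs1 : s.re < 1 := by linarith
  have hE : s = 1 / 2 + Complex.I * (-Complex.I * (s - 1 / 2)) := by
    linear_combination (s - 1 / 2) * Complex.I_sq
  have hIm : 0 ≤ (-Complex.I * (s - 1 / 2)).im := by
    simp
    linarith
  have hmono : Monotone fun v : ℝ => wronskianOne v s :=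
    monotone_of_hasDerivAt_nonneg (fun v => hasDerivAt_wronskianOne v hE hs1)
      (fun v => mul_nonneg hIm (by positivity))
  have hev := (tendsto_wronskianOne_factor hs1).eventually (lt_mem_nhds one_pos)
  obtain ⟨v, hv, hvu⟩ := (hev.and (eventually_le_atBot u)).exists
  refine lt_of_lt_of_le ?_ (hmono hvu)
  simp only
  rw [wronskianOne_eq v hs1]
  exact mul_pos hv (Real.rpow_pos_of_pos (Real.exp_pos v) _)

theorem mainTheorem4 :
    -- the functions `φ_a^±` are well defined
    (∀ a : ℝ, 0 < a →
      (∃! φ : ℂ → ℂ, IsCosineSolution 1 a φ) ∧ (∃! φ : ℂ → ℂ, IsCosineSolution (-1) a φ)) ∧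
    -- the value on the critical line
    (∀ E u : ℝ, (-(solJ u (1 / 2 + Complex.I * E)) * conj (solK u (1 / 2 + Complex.I * E))).im = 1) ∧
    -- no zeros on the critical line
    (∀ (u : ℝ) (s : ℂ), s.re = 1 / 2 → solJ u s ≠ 0 ∧ solK u s ≠ 0) ∧
    -- positivity and no zeros to the left of the critical line
    (∀ (u : ℝ) (s : ℂ), s.re < 1 / 2 → 0 < wronskianOne u s ∧ solJ u s ≠ 0 ∧ solK u s ≠ 0) ∧
    -- the differential identity, where `s = 1/2 + iE`
    (∀ (u : ℝ) (E s : ℂ), s = 1 / 2 + Complex.I * E → s.re < 1 →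
      HasDerivAt (fun v : ℝ => wronskianOne v s)
        (E.im * (‖solJ u s‖ ^ 2 + ‖solK u s‖ ^ 2)) u) ∧
    -- the asymptotics as `a = exp u → 0`
    (∀ s : ℂ, s.re < 1 →
      ((fun u : ℝ => solJ u s) ~[atBot] fun u : ℝ => (Real.exp u : ℂ) ^ (1 / 2 - s)) ∧
      ((fun u : ℝ => solK u s) ~[atBot] fun u : ℝ => Complex.I * (Real.exp u : ℂ) ^ (1 / 2 - s)) ∧
      ((fun u : ℝ => wronskianOne u s) ~[atBot] fun u : ℝ => Real.exp u ^ (1 - 2 * s.re))) := by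
  refine ⟨fun a ha => ⟨?_, ?_⟩, fun E u => ?_, fun u s hs => ?_, fun u s hs => ?_, fun u E s hE hs => ?_,
    fun s hs => ⟨solJ_isEquivalent hs, solK_isEquivalent hs, wronskianOne_isEquivalent hs⟩⟩
  · simpa using existsUnique_isCosineSolution ha (ε := 1) (by norm_num)
  · simpa using existsUnique_isCosineSolution ha (ε := -1) (by norm_num)
  · exact wronskianOne_eq_one u (by simp)
  · exact solJ_ne_zero_and_solK_ne_zero (by rw [wronskianOne_eq_one u hs]; exact one_ne_zero)
  · exact ⟨wronskianOne_pos u hs, solJ_ne_zero_and_solK_ne_zero (wronskianOne_pos u hs).ne'⟩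
  · exact hasDerivAt_wronskianOne u hE hs
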